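/- Let $\Bbbk$ be a field of characteristic zero, and let $W_+$ be the positive Witt algebra, that is, the Lie algebra over $\Bbbk$ with basis $\{e_i : i \in \mathbb{Z}_{\ge 1}\}$ and Lie bracket $[e_i,e_j]=(j-i)\,e_{i+j}$. Equip the symmetric algebra $\mathrm{S}(W_+)$ with the Poisson bracket induced by the Lie bracket of $W_+$, i.e. the unique Poisson bracket with $\{x,y\}=[x,y]$ for $x,y\in W_+$. An ideal $I$ of $\mathrm{S}(W_+)$ is called Poisson if $\{a,b\}\in I$ for all $a\in \mathrm{S}(W_+)$ and $b\in I$, and radical if $I=\sqrt I$. Then $\mathrm{S}(W_+)$ satisfies the ascending chain condition on radical Poisson ideals: if $I_0\subseteq I_1\subseteq I_2\subseteq\cdots$ is an ascending sequence of ideals of $\mathrm{S}(W_+)$, each of which is both radical and Poisson, then there is $N$ such that $I_n=I_N$ for all $n\ge N$. -/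

import Mathlib

/-- A Poisson bracket on a commutative `R`-algebra `A`: an `R`-bilinear Lie bracket on `A` which is
a derivation in each argument. -/
class PoissonAlgebra (R A : Type*) [CommRing R] [CommRing A] [Algebra R A] where
  /-- The Poisson bracket `{a, b}`. -/
  bracket : A →ₗ[R] A →ₗ[R] A
  bracket_self : ∀ a, bracket a a = 0
  bracket_jacobi : ∀ a b c,
    bracket a (bracket b c) + bracket b (bracket c a) + bracket c (bracket a b) = 0
  bracket_mul : ∀ a b c, bracket a (b * c) = bracket a b * c + b * bracket a c

/-- An ideal `I` of a Poisson algebra `A` is a Poisson ideal if `{a, b} ∈ I` for all `a ∈ A` and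
`b ∈ I`. -/
def Ideal.IsPoisson (R : Type*) {A : Type*} [CommRing R] [CommRing A] [Algebra R A]
    [PoissonAlgebra R A] (I : Ideal A) : Prop :=
  ∀ a : A, ∀ b ∈ I, PoissonAlgebra.bracket (R := R) a b ∈ I

namespace SymmetricAlgebra

section Derivation

variable {R M : Type*} [CommRing R] [AddCommGroup M] [Module R M]

theorem derivation_eq_of_ι {D₁ D₂ : Derivation R (SymmetricAlgebra R M) (SymmetricAlgebra R M)}
    (h : ∀ x, D₁ (ι R M x) = D₂ (ι R M x)) : D₁ = D₂ := by
  ext a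
  induction a using SymmetricAlgebra.induction with
  | algebraMap r => simp
  | ι x => exact h x
  | mul a b ha hb => simp [ha, hb]
  | add a b ha hb => simp [ha, hb]

/-- The algebra map `a ↦ (a, D a)` to the dual numbers over the symmetric algebra, where `D` is the
derivation extending `f`. -/
noncomputable def dualLift (f : M →ₗ[R] SymmetricAlgebra R M) :
    SymmetricAlgebra R M →ₐ[R] TrivSqZeroExt (SymmetricAlgebra R M) (SymmetricAlgebra R M) :=
  lift
    { toFun := fun x => TrivSqZeroExt.inl (ι R M x) + TrivSqZeroExt.inr (f x)
      map_add' := fun x y => by ext <;> simp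
      map_smul' := fun r x => by ext <;> simp }

theorem dualLift_ι (f : M →ₗ[R] SymmetricAlgebra R M) (x : M) :
    dualLift f (ι R M x) = TrivSqZeroExt.inl (ι R M x) + TrivSqZeroExt.inr (f x) :=
  lift_ι_apply _ x

theorem fst_dualLift (f : M →ₗ[R] SymmetricAlgebra R M) (a : SymmetricAlgebra R M) :
    (dualLift f a).fst = a := by
  induction a using SymmetricAlgebra.induction with
  | algebraMap r => rw [AlgHom.commutes]; rfl
  | ι x => simp [dualLift_ι]
  | mul a b ha hb => simp [ha, hb]
  | add a b ha hb => simp [ha, hb]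

/-- The unique derivation of the symmetric algebra extending a linear map on generators. -/
noncomputable def liftDerivation (f : M →ₗ[R] SymmetricAlgebra R M) :
    Derivation R (SymmetricAlgebra R M) (SymmetricAlgebra R M) :=
  Derivation.mk'
    { toFun := fun a => (dualLift f a).snd
      map_add' := fun a b => by simp
      map_smul' := fun r a => by simp }
    (fun a b => by simp [fst_dualLift, mul_comm])

@[simp]
theorem liftDerivation_ι (f : M →ₗ[R] SymmetricAlgebra R M) (x : M) :
    liftDerivation f (ι R M x) = f x := by
  change (dualLift f (ι R M x)).snd = f x
  simp [dualLift_ι]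

end Derivation

section Poisson

variable {R L : Type*} [CommRing R] [LieRing L] [LieAlgebra R L]

/-- The adjoint action of `x ∈ L` on the symmetric algebra of `L`, by derivations. -/
noncomputable def adDerivation (x : L) :
    Derivation R (SymmetricAlgebra R L) (SymmetricAlgebra R L) :=
  liftDerivation (ι R L ∘ₗ (LieAlgebra.ad R L x : L →ₗ[R] L))

@[simp]
theorem adDerivation_ι (x y : L) : adDerivation (R := R) x (ι R L y) = ι R L ⁅x, y⁆ := by
  simp [adDerivation]

theorem adDerivation_add (x y : L) :
    adDerivation (R := R) (x + y) = adDerivation x + adDerivation y :=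
  derivation_eq_of_ι fun z => by simp

theorem adDerivation_smul (r : R) (x : L) :
    adDerivation (R := R) (r • x) = r • adDerivation x :=
  derivation_eq_of_ι fun z => by simp

/-- The Hamiltonian derivation `{a, ·}`: on generators it is `{a, y} = -(y · a)`, where `y · a` is
the adjoint action. -/
noncomputable def hamiltonian (a : SymmetricAlgebra R L) :
    Derivation R (SymmetricAlgebra R L) (SymmetricAlgebra R L) :=
  liftDerivation
    { toFun := fun y => -adDerivation y a
      map_add' := fun x y => by simp [adDerivation_add, add_comm]
      map_smul' := fun r x => by simp [adDerivation_smul] }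

@[simp]
theorem hamiltonian_ι_right (a : SymmetricAlgebra R L) (y : L) :
    hamiltonian a (ι R L y) = -adDerivation y a := by
  simp [hamiltonian]

theorem hamiltonian_ι (x : L) : hamiltonian (ι R L x) = adDerivation x :=
  derivation_eq_of_ι fun y => by
    rw [hamiltonian_ι_right, adDerivation_ι, adDerivation_ι, ← map_neg, lie_skew]

theorem hamiltonian_add (a b : SymmetricAlgebra R L) :
    hamiltonian (a + b) = hamiltonian a + hamiltonian b :=
  derivation_eq_of_ι fun y => by simp [add_comm]

theorem hamiltonian_smul (r : R) (a : SymmetricAlgebra R L) :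
    hamiltonian (r • a) = r • hamiltonian a :=
  derivation_eq_of_ι fun y => by simp

theorem hamiltonian_mul (a b : SymmetricAlgebra R L) :
    hamiltonian (a * b) = a • hamiltonian b + b • hamiltonian a :=
  derivation_eq_of_ι fun y => by simp [add_comm]

theorem hamiltonian_algebraMap (r : R) :
    hamiltonian (algebraMap R (SymmetricAlgebra R L) r) = 0 :=
  derivation_eq_of_ι fun y => by simp

theorem hamiltonian_skew (a b : SymmetricAlgebra R L) : hamiltonian a b = -hamiltonian b a := by
  induction b using SymmetricAlgebra.induction with
  | algebraMap r => simp [hamiltonian_algebraMap]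
  | ι y => rw [hamiltonian_ι_right, hamiltonian_ι]
  | mul b c hb hc => simp [hamiltonian_mul, hb, hc, add_comm]
  | add b c hb hc => simp [hamiltonian_add, hb, hc, add_comm]

theorem hamiltonian_self (a : SymmetricAlgebra R L) : hamiltonian a a = 0 := by
  induction a using SymmetricAlgebra.induction with
  | algebraMap r => simp
  | ι y => simp
  | mul a b ha hb =>
    rw [hamiltonian_mul]
    simp only [Derivation.add_apply, Derivation.smul_apply, Derivation.leibniz, ha, hb, smul_eq_mul]
    rw [hamiltonian_skew a b]; ring
  | add a b ha hb =>
    rw [hamiltonian_add]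
    simp only [Derivation.add_apply, map_add, ha, hb]
    rw [hamiltonian_skew a b]; ring

theorem hamiltonian_ι_lie (x y : L) :
    ⁅hamiltonian (ι R L x), hamiltonian (ι R L y)⁆ = hamiltonian (ι R L ⁅x, y⁆) :=
  derivation_eq_of_ι fun z => by
    simp [Derivation.commutator_apply, hamiltonian_ι, ← map_sub]

theorem ι_lie_hamiltonian (x : L) (b : SymmetricAlgebra R L) :
    ⁅hamiltonian (ι R L x), hamiltonian b⁆ = hamiltonian (hamiltonian (ι R L x) b) := by
  induction b using SymmetricAlgebra.induction with
  | algebraMap r =>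
    have h0 : hamiltonian (0 : SymmetricAlgebra R L) = 0 := by
      simpa using hamiltonian_algebraMap (R := R) (L := L) 0
    ext d
    rw [Derivation.commutator_apply, hamiltonian_algebraMap, Derivation.map_algebraMap, h0]
    simp
  | ι y => rw [hamiltonian_ι_lie, hamiltonian_ι x, adDerivation_ι]
  | mul b c hb hc =>
    ext d
    have h1 := Derivation.congr_fun hb d
    have h2 := Derivation.congr_fun hc d
    simp only [Derivation.commutator_apply] at h1 h2
    simp only [Derivation.commutator_apply, hamiltonian_mul, hamiltonian_add,
      Derivation.add_apply, Derivation.smul_apply, Derivation.leibniz, smul_eq_mul, map_add,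
      ← h1, ← h2]
    ring
  | add b c hb hc =>
    ext d
    have h1 := Derivation.congr_fun hb d
    have h2 := Derivation.congr_fun hc d
    simp only [Derivation.commutator_apply] at h1 h2
    simp only [Derivation.commutator_apply, hamiltonian_add, Derivation.add_apply, map_add,
      ← h1, ← h2]
    ring

theorem hamiltonian_lie (a b : SymmetricAlgebra R L) :
    ⁅hamiltonian a, hamiltonian b⁆ = hamiltonian (hamiltonian a b) :=
  derivation_eq_of_ι fun x => by
    have h := Derivation.congr_fun (ι_lie_hamiltonian x a) b
    rw [Derivation.commutator_apply] at h ⊢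
    rw [hamiltonian_skew b (ι R L x), hamiltonian_skew a (ι R L x),
      hamiltonian_skew (hamiltonian a b) (ι R L x), map_neg, map_neg,
      hamiltonian_skew b (hamiltonian (ι R L x) a), ← h]
    ring

/-- The Poisson structure on the symmetric algebra of a Lie algebra `L`: the unique Poisson bracket
with `{x, y} = [x, y]` for `x, y ∈ L`. -/
noncomputable instance instPoissonAlgebra : PoissonAlgebra R (SymmetricAlgebra R L) where
  bracket :=
    { toFun := fun a => (hamiltonian a).toLinearMap
      map_add' := fun a b => by rw [hamiltonian_add]; rfl
      map_smul' := fun r a => by rw [hamiltonian_smul]; rfl }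
  bracket_self a := hamiltonian_self a
  bracket_jacobi a b c := by
    change hamiltonian a (hamiltonian b c) + hamiltonian b (hamiltonian c a)
      + hamiltonian c (hamiltonian a b) = 0
    have h := Derivation.congr_fun (hamiltonian_lie a b) c
    rw [Derivation.commutator_apply] at h
    rw [hamiltonian_skew c (hamiltonian a b), ← h, hamiltonian_skew c a, map_neg]
    ring
  bracket_mul a b c := by
    change hamiltonian a (b * c) = hamiltonian a b * c + b * hamiltonian a c
    rw [Derivation.leibniz, smul_eq_mul, smul_eq_mul]
    ring

theorem poisson_bracket_ι (x y : L) :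
    PoissonAlgebra.bracket (R := R) (ι R L x) (ι R L y) = ι R L ⁅x, y⁆ := by
  change hamiltonian (ι R L x) (ι R L y) = _
  rw [hamiltonian_ι, adDerivation_ι]

end Poisson

end SymmetricAlgebra

/-- The underlying module of the positive Witt algebra over `k`: the free module with basis
`e i`, `i` a positive integer. -/
def PositiveWitt (k : Type*) [CommRing k] : Type _ := ℕ+ →₀ k

namespace PositiveWitt

variable {k : Type*} [CommRing k]

noncomputable instance : AddCommGroup (PositiveWitt k) := inferInstanceAs (AddCommGroup (ℕ+ →₀ k))

noncomputable instance : Module k (PositiveWitt k) := inferInstanceAs (Module k (ℕ+ →₀ k))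

variable (k) in
/-- The basis `e 1, e 2, e 3, …` of the positive Witt algebra. -/
noncomputable def e : Module.Basis ℕ+ k (PositiveWitt k) :=
  Module.Basis.ofRepr (LinearEquiv.refl k (ℕ+ →₀ k))

/-- The bilinear map with `[e i, e j] = (j - i) e (i + j)`. -/
noncomputable def lieBilin : PositiveWitt k →ₗ[k] PositiveWitt k →ₗ[k] PositiveWitt k :=
  (e k).constr k fun i => (e k).constr k fun j => (((j : ℕ) : k) - ((i : ℕ) : k)) • e k (i + j)

theorem lieBilin_e (i j : ℕ+) :
    lieBilin (e k i) (e k j) = (((j : ℕ) : k) - ((i : ℕ) : k)) • e k (i + j) := by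
  simp [lieBilin]

theorem lieBilin_skew (x y : PositiveWitt k) : lieBilin x y = -lieBilin y x := by
  have h : (lieBilin : PositiveWitt k →ₗ[k] _) = -lieBilin.flip :=
    (e k).ext fun i => (e k).ext fun j => by
      simp only [LinearMap.neg_apply, LinearMap.flip_apply, lieBilin_e]
      rw [add_comm j i, ← neg_smul, neg_sub]
  exact LinearMap.congr_fun₂ h x y

theorem span_induction {p : PositiveWitt k → Prop} (zero : p 0) (basis : ∀ i, p (e k i))
    (add : ∀ x y, p x → p y → p (x + y)) (smul : ∀ (r : k) x, p x → p (r • x))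
    (x : PositiveWitt k) : p x := by
  have hx : x ∈ Submodule.span k (Set.range (e k)) := by simp [(e k).span_eq]
  induction hx using Submodule.span_induction with
  | mem x hx => obtain ⟨i, rfl⟩ := hx; exact basis i
  | zero => exact zero
  | add x y _ _ hx hy => exact add x y hx hy
  | smul r x _ hx => exact smul r x hx

theorem lieBilin_self (x : PositiveWitt k) : lieBilin x x = 0 := by
  induction x using span_induction with
  | zero => simp
  | basis i => simp [lieBilin_e]
  | add x y hx hy =>
    simp only [map_add, LinearMap.add_apply, hx, hy, lieBilin_skew y x]
    abel
  | smul r x hx => simp [hx]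

theorem lieBilin_leibniz (x y z : PositiveWitt k) :
    lieBilin x (lieBilin y z) = lieBilin (lieBilin x y) z + lieBilin y (lieBilin x z) := by
  induction x using span_induction with
  | zero => simp
  | add x x' hx hx' => simp only [map_add, LinearMap.add_apply, hx, hx']; abel
  | smul r x hx => simp [hx]
  | basis i =>
    induction y using span_induction with
    | zero => simp
    | add y y' hy hy' => simp only [map_add, LinearMap.add_apply, hy, hy']; abel
    | smul r y hy => simp [hy]
    | basis j =>
      induction z using span_induction with
      | zero => simp
      | add z z' hz hz' => simp only [map_add, hz, hz']; abel
      | smul r z hz => simp [hz]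
      | basis l =>
        simp only [lieBilin_e, map_smul, LinearMap.smul_apply, smul_smul]
        rw [add_left_comm j i l, ← add_assoc i j l, ← add_smul]
        congr 1
        push_cast
        ring

noncomputable instance : LieRing (PositiveWitt k) where
  bracket x y := lieBilin x y
  add_lie x y z := by simp
  lie_add x y z := by simp
  lie_self x := lieBilin_self x
  leibniz_lie x y z := lieBilin_leibniz x y z

noncomputable instance : LieAlgebra k (PositiveWitt k) where
  lie_smul r x y := map_smul (lieBilin x) r y

theorem e_lie_e (i j : ℕ+) :
    ⁅e k i, e k j⁆ = (((j : ℕ) : k) - ((i : ℕ) : k)) • e k (i + j) :=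
  lieBilin_e i j

end PositiveWitt

/-!
The argument is that of the Ritt–Raudenbush basis theorem. The radical Poisson closure of ideals
satisfies `cl I * cl J ≤ cl (I * J)`. Suppose some radical Poisson ideal is not the closure of a
finitely generated one, and let `P` be maximal among those; it then suffices to find `s ∉ P` and a
finitely generated `G ≤ P` such that `P * (s) ≤ cl G`.

Take a nonzero polynomial `f ∈ P` of minimal degree, and let `s` be its derivative with respect to
its last variable `e n`. By minimality, `s ∉ P`. For `m > 2 n` and `y = e (m - n)`, the bracket
`{y, f}` is a nonzero multiple of `s * e m` plus a polynomial in the variables before `e m`. So,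
modulo a Poisson ideal containing `f` and after inverting `s`, every `e m` becomes a polynomial in
finitely many variables, and Noetherianity of a finitely generated subalgebra provides `G`.
-/

namespace PoissonAlgebra

section PoissonRadical

variable {R A : Type*} [CommRing R] [CommRing A] [Algebra R A] [PoissonAlgebra R A]

theorem isRadical_colon {J : Ideal A} (hJ : J.IsRadical) (S : Set A) : (J.colon S).IsRadical := by
  rintro x ⟨n, hx⟩
  refine Submodule.mem_colon.2 fun s hs => hJ ⟨n + 1, ?_⟩
  have hxs : x ^ n * s ∈ J := Submodule.mem_colon.1 hx s hs
  convert J.mul_mem_left (x * s ^ n) hxs using 1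
  rw [smul_eq_mul]
  ring

theorem isPoisson_colon {J : Ideal A} (hrad : J.IsRadical) (hJ : J.IsPoisson R) (S : Set A) :
    (J.colon S).IsPoisson R := by
  intro a x hx
  refine Submodule.mem_colon.2 fun s hs => hrad ⟨2, ?_⟩
  have hxs : x * s ∈ J := Submodule.mem_colon.1 hx s hs
  have hbracket : bracket (R := R) a x * s + x * bracket (R := R) a s ∈ J :=
    bracket_mul (R := R) a x s ▸ hJ a _ hxs
  -- `({a, x} s)² = {a, x} s {a, x s} - {a, x} {a, s} (x s)`
  convert J.sub_mem (J.mul_mem_left (bracket (R := R) a x * s) hbracket)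
    (J.mul_mem_left (bracket (R := R) a x * bracket (R := R) a s) hxs) using 1
  rw [smul_eq_mul]
  ring

variable (R A) in
/-- The closure operator sending an ideal to the smallest radical Poisson ideal containing it. Its
closed elements are by definition the radical Poisson ideals. -/
noncomputable def poissonRadical : ClosureOperator (Ideal A) :=
  .ofCompletePred (fun J => J.IsRadical ∧ J.IsPoisson R) fun _ hc =>
    ⟨fun _ ⟨n, hx⟩ => Submodule.mem_sInf.2 fun J hJ =>
        (hc J hJ).1 ⟨n, Submodule.mem_sInf.1 hx J hJ⟩,
      fun a _ hx => Submodule.mem_sInf.2 fun J hJ =>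
        (hc J hJ).2 a _ (Submodule.mem_sInf.1 hx J hJ)⟩

theorem isClosed_colon {J : Ideal A} (hJ : (poissonRadical R A).IsClosed J) (S : Set A) :
    (poissonRadical R A).IsClosed (J.colon S) :=
  ⟨isRadical_colon hJ.1 S, isPoisson_colon hJ.1 hJ.2 S⟩

theorem isClosed_sSup_of_directedOn {c : Set (Ideal A)} (hne : c.Nonempty)
    (hdir : DirectedOn (· ≤ ·) c) (hc : ∀ J ∈ c, (poissonRadical R A).IsClosed J) :
    (poissonRadical R A).IsClosed (sSup c) := by
  have mem_iff (x : A) : x ∈ sSup c ↔ ∃ J ∈ c, x ∈ J := Submodule.mem_sSup_of_directed hne hdir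
  constructor
  · rintro x ⟨n, hx⟩
    obtain ⟨J, hJ, hxJ⟩ := (mem_iff _).1 hx
    exact (mem_iff _).2 ⟨J, hJ, (hc J hJ).1 ⟨n, hxJ⟩⟩
  · intro a x hx
    obtain ⟨J, hJ, hxJ⟩ := (mem_iff _).1 hx
    exact (mem_iff _).2 ⟨J, hJ, (hc J hJ).2 a x hxJ⟩

theorem poissonRadical_mul_le (I J : Ideal A) :
    poissonRadical R A I * poissonRadical R A J ≤ poissonRadical R A (I * J) := by
  set K := poissonRadical R A (I * J)
  have hK : (poissonRadical R A).IsClosed K := (poissonRadical R A).isClosed_closure _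
  have hI : poissonRadical R A I ≤ K.colon J :=
    ClosureOperator.closure_min (fun x hx => Submodule.mem_colon.2 fun y hy =>
      (poissonRadical R A).le_closure _ (Ideal.mul_mem_mul hx hy)) (isClosed_colon hK _)
  have hJ : poissonRadical R A J ≤ K.colon (poissonRadical R A I) :=
    ClosureOperator.closure_min (fun y hy => Submodule.mem_colon.2 fun x hx => by
      rw [smul_eq_mul, mul_comm]
      exact Submodule.mem_colon.1 (hI hx) y hy) (isClosed_colon hK _)
  refine Ideal.mul_le.2 fun x hx y hy => ?_
  rw [mul_comm]
  exact Submodule.mem_colon.1 (hJ hy) x hx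

theorem poissonRadical_inf_le (I J : Ideal A) :
    poissonRadical R A I ⊓ poissonRadical R A J ≤ poissonRadical R A (I * J) := fun x hx =>
  ((poissonRadical R A).isClosed_closure (I * J)).1
    ⟨2, pow_two x ▸ poissonRadical_mul_le I J (Ideal.mul_mem_mul hx.1 hx.2)⟩

theorem exists_le_of_fg_of_le_sSup {c : Set (Ideal A)} (hne : c.Nonempty)
    (hdir : DirectedOn (· ≤ ·) c) {G : Ideal A} (hG : G.FG) (hle : G ≤ sSup c) :
    ∃ J ∈ c, G ≤ J :=
  (CompleteLattice.isCompactElement_iff_le_of_directed_sSup_le _ G).1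
    ((Submodule.fg_iff_compact G).1 hG) c hne hdir hle

theorem exists_fg_le_poissonRadical_sup {H P Q : Ideal A} (hH : H.FG)
    (hle : H ≤ poissonRadical R A (P ⊔ Q)) :
    ∃ K ≤ P, K.FG ∧ H ≤ poissonRadical R A (K ⊔ Q) := by
  let c : Set (Ideal A) := (fun K => poissonRadical R A (K ⊔ Q)) '' {K | K ≤ P ∧ K.FG}
  have hne : c.Nonempty := ⟨_, ⊥, ⟨bot_le, Submodule.fg_bot⟩, rfl⟩
  have hdir : DirectedOn (· ≤ ·) c := by
    rintro _ ⟨K, hK, rfl⟩ _ ⟨L, hL, rfl⟩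
    exact ⟨_, ⟨K ⊔ L, ⟨sup_le hK.1 hL.1, Submodule.FG.sup hK.2 hL.2⟩, rfl⟩,
      (poissonRadical R A).monotone (sup_le_sup_right le_sup_left Q),
      (poissonRadical R A).monotone (sup_le_sup_right le_sup_right Q)⟩
  have hclosed : (poissonRadical R A).IsClosed (sSup c) := by
    refine isClosed_sSup_of_directedOn hne hdir ?_
    rintro _ ⟨K, -, rfl⟩
    exact (poissonRadical R A).isClosed_closure _
  have hK {K : Ideal A} (hKP : K ≤ P) (hfg : K.FG) : K ⊔ Q ≤ sSup c :=
    ((poissonRadical R A).le_closure _).trans (le_sSup ⟨K, ⟨hKP, hfg⟩, rfl⟩)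
  have hPQ : P ⊔ Q ≤ sSup c := by
    refine sup_le (fun p hp => ?_) (le_sup_right.trans (hK bot_le Submodule.fg_bot))
    exact hK ((Ideal.span_singleton_le_iff_mem P).2 hp) (Submodule.fg_span_singleton p)
      (Ideal.mem_sup_left (Ideal.mem_span_singleton_self p))
  obtain ⟨_, ⟨K, ⟨hKP, hfg⟩, rfl⟩, hHK⟩ :=
    exists_le_of_fg_of_le_sSup hne hdir hH (hle.trans (ClosureOperator.closure_min hPQ hclosed))
  exact ⟨K, hKP, hfg, hHK⟩

variable (R) in
/-- A radical Poisson ideal is radically finitely generated if it is the smallest radical Poisson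
ideal containing some finite set. -/
def IsRadicallyFG (P : Ideal A) : Prop :=
  ∃ G : Ideal A, G.FG ∧ poissonRadical R A G = P

theorem isRadicallyFG_of_mul_le {P Q G : Ideal A} (hP : (poissonRadical R A).IsClosed P)
    (hG : G.FG) (hGP : G ≤ P) (hmul : P * Q ≤ poissonRadical R A G)
    (hPQ : IsRadicallyFG R (poissonRadical R A (P ⊔ Q))) : IsRadicallyFG R P := by
  obtain ⟨H, hH, hHPQ⟩ := hPQ
  obtain ⟨K, hKP, hK, hHK⟩ := exists_fg_le_poissonRadical_sup (R := R) hH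
    (hHPQ ▸ (poissonRadical R A).le_closure H)
  have hPK : P ≤ poissonRadical R A (K ⊔ Q) :=
    calc P ≤ poissonRadical R A (P ⊔ Q) := le_sup_left.trans ((poissonRadical R A).le_closure _)
      _ = poissonRadical R A H := hHPQ.symm
      _ ≤ poissonRadical R A (K ⊔ Q) :=
        ClosureOperator.closure_min hHK ((poissonRadical R A).isClosed_closure _)
  have hPKQ : P * (K ⊔ Q) ≤ poissonRadical R A (G ⊔ K) := by
    have hK : P * K ≤ G ⊔ K := Ideal.mul_le_right.trans le_sup_right
    have hQ : P * Q ≤ poissonRadical R A (G ⊔ K) :=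
      hmul.trans ((poissonRadical R A).monotone le_sup_left)
    rw [Ideal.mul_sup]
    exact sup_le (hK.trans ((poissonRadical R A).le_closure _)) hQ
  refine ⟨G ⊔ K, Submodule.FG.sup hG hK,
    (ClosureOperator.closure_min (sup_le hGP hKP) hP).antisymm ?_⟩
  calc P ≤ poissonRadical R A P ⊓ poissonRadical R A (K ⊔ Q) :=
        le_inf ((poissonRadical R A).le_closure P) hPK
    _ ≤ poissonRadical R A (P * (K ⊔ Q)) := poissonRadical_inf_le P (K ⊔ Q)
    _ ≤ poissonRadical R A (G ⊔ K) :=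
      ClosureOperator.closure_min hPKQ ((poissonRadical R A).isClosed_closure _)

theorem exists_le_maximal_not_isRadicallyFG {P : Ideal A} (hP : (poissonRadical R A).IsClosed P)
    (hfg : ¬ IsRadicallyFG R P) :
    ∃ M, P ≤ M ∧ Maximal (fun J => (poissonRadical R A).IsClosed J ∧ ¬ IsRadicallyFG R J) M := by
  refine zorn_le_nonempty₀ {J | (poissonRadical R A).IsClosed J ∧ ¬ IsRadicallyFG R J}
    (fun c hc hchain J hJ => ⟨sSup c, ⟨?_, ?_⟩, fun _ => le_sSup⟩) P ⟨hP, hfg⟩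
  · exact isClosed_sSup_of_directedOn ⟨J, hJ⟩ hchain.directedOn fun K hK => (hc hK).1
  · rintro ⟨G, hG, hGc⟩
    obtain ⟨K, hK, hGK⟩ := exists_le_of_fg_of_le_sSup ⟨J, hJ⟩ hchain.directedOn hG
      (hGc ▸ (poissonRadical R A).le_closure G)
    exact (hc hK).2 ⟨G, hG, (ClosureOperator.closure_min hGK (hc hK).1).antisymm
      (hGc ▸ le_sSup hK)⟩

theorem isRadicallyFG_of_forall_exists_mul_le
    (h : ∀ P : Ideal A, (poissonRadical R A).IsClosed P → P ≠ ⊥ → P ≠ ⊤ →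
      ∃ Q G : Ideal A, ¬ Q ≤ P ∧ G.FG ∧ G ≤ P ∧ P * Q ≤ poissonRadical R A G)
    {P : Ideal A} (hP : (poissonRadical R A).IsClosed P) : IsRadicallyFG R P := by
  by_contra hfg
  obtain ⟨M, -, hM⟩ := exists_le_maximal_not_isRadicallyFG hP hfg
  obtain ⟨hclosed, hMfg⟩ := hM.prop
  have hbot : M ≠ ⊥ := fun hM => hMfg ⟨⊥, Submodule.fg_bot, hM ▸ hclosed.closure_eq⟩
  have htop : M ≠ ⊤ := fun hM => hMfg ⟨⊤, Ideal.fg_top A, hM ▸ hclosed.closure_eq⟩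
  obtain ⟨Q, G, hQ, hG, hGM, hmul⟩ := h M hclosed hbot htop
  refine hMfg (isRadicallyFG_of_mul_le hclosed hG hGM hmul (by_contra fun hMQ => hQ ?_))
  have hle : M ⊔ Q ≤ poissonRadical R A (M ⊔ Q) := (poissonRadical R A).le_closure _
  exact (le_sup_right.trans hle).trans
    (hM.le_of_ge ⟨(poissonRadical R A).isClosed_closure _, hMQ⟩ (le_sup_left.trans hle))

theorem exists_forall_ge_eq_of_isRadicallyFG
    (h : ∀ P : Ideal A, (poissonRadical R A).IsClosed P → IsRadicallyFG R P)
    {I : ℕ → Ideal A} (hI : ∀ n, (poissonRadical R A).IsClosed (I n)) (hmono : Monotone I) :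
    ∃ N, ∀ n, N ≤ n → I n = I N := by
  have hne : (Set.range I).Nonempty := Set.range_nonempty I
  have hdir : DirectedOn (· ≤ ·) (Set.range I) := directedOn_range.2 hmono.directed_le
  obtain ⟨G, hG, hGI⟩ := h _ (isClosed_sSup_of_directedOn hne hdir (Set.forall_mem_range.2 hI))
  obtain ⟨_, ⟨N, rfl⟩, hGN⟩ := exists_le_of_fg_of_le_sSup hne hdir hG
    (hGI ▸ (poissonRadical R A).le_closure G)
  refine ⟨N, fun n hn => le_antisymm ?_ (hmono hn)⟩
  calc I n ≤ sSup (Set.range I) := le_sSup ⟨n, rfl⟩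
    _ = poissonRadical R A G := hGI.symm
    _ ≤ I N := ClosureOperator.closure_min hGN (hI N)

end PoissonRadical

end PoissonAlgebra

section PartialDerivatives

open MvPolynomial

variable {σ : Type*}

theorem totalDegree_pderiv_lt {R : Type*} [CommSemiring R] {i : σ} {p : MvPolynomial σ R}
    (hp : pderiv i p ≠ 0) : (pderiv i p).totalDegree < p.totalDegree := by
  classical
  have degree_lt (m : σ →₀ ℕ) (hm : m ∈ (pderiv i p).support) :
      (m.sum fun _ n => n) < p.totalDegree := by
    rw [mem_support_iff, coeff_pderiv] at hm
    have hle := le_totalDegree (mem_support_iff.2 (left_ne_zero_of_mul hm))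
    rwa [Finsupp.sum_add_index' (by simp) (by simp), Finsupp.sum_single_index rfl] at hle
  obtain ⟨m, hm⟩ := support_nonempty.2 hp
  exact (Finset.sup_lt_iff (pos_of_gt (degree_lt m hm))).2 degree_lt

theorem pderiv_ne_zero_of_mem_vars {R : Type*} [CommSemiring R] [NoZeroDivisors R] [CharZero R]
    {i : σ} {p : MvPolynomial σ R} (hi : i ∈ p.vars) : pderiv i p ≠ 0 := by
  classical
  obtain ⟨d, hd, hid⟩ := (mem_vars_iff_mem_support i).1 hi
  intro hzero
  have hcoeff := coeff_pderiv (i := i) p (d - Finsupp.single i 1)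
  rw [Finsupp.sub_add_single_one_cancel (Finsupp.mem_support_iff.1 hid), hzero, coeff_zero]
    at hcoeff
  exact mul_ne_zero (mem_support_iff.1 hd) (Nat.cast_add_one_ne_zero _) hcoeff.symm

theorem exists_mem_forall_pderiv_notMem {K : Type*} [Field K] [CharZero K]
    {P : Ideal (MvPolynomial σ K)} (hbot : P ≠ ⊥) (htop : P ≠ ⊤) :
    ∃ f ∈ P, f.vars.Nonempty ∧ ∀ i ∈ f.vars, pderiv i f ∉ P := by
  obtain ⟨f, ⟨hfP, hf⟩, hmin⟩ := WellFounded.has_min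
    (InvImage.wf (totalDegree (σ := σ) (R := K)) wellFounded_lt) {f | f ∈ P ∧ f ≠ 0}
    (Submodule.exists_mem_ne_zero_of_ne_bot hbot)
  refine ⟨f, hfP, ?_, fun i hi hderiv => ?_⟩
  · refine Finset.nonempty_iff_ne_empty.2 fun hvars => htop ?_
    have hC : f = C (f.coeff 0) := vars_eq_empty_iff_eq_C.1 hvars
    have hcoeff : f.coeff 0 ≠ 0 := fun hzero => hf (by rw [hC, hzero, map_zero])
    exact Ideal.eq_top_of_isUnit_mem _ (hC ▸ hfP) ((IsUnit.mk0 _ hcoeff).map C)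
  · have hne := pderiv_ne_zero_of_mem_vars hi
    exact hmin _ ⟨hderiv, hne⟩ (totalDegree_pderiv_lt hne)

variable {R A : Type*} [CommRing R] [CommRing A] [Algebra R A] {u : σ → A} {C : Subalgebra R A}
  {s : Set σ}

theorem aeval_mem_of_mem_supported (hu : ∀ i ∈ s, u i ∈ C) {f : MvPolynomial σ R}
    (hf : f ∈ supported R s) : aeval u f ∈ C := by
  have hle : (supported R s).map (aeval u) ≤ C := by
    rw [supported_eq_adjoin_X, AlgHom.map_adjoin, Algebra.adjoin_le_iff]
    rintro _ ⟨_, ⟨i, hi, rfl⟩, rfl⟩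
    exact (aeval_X (R := R) u i).symm ▸ hu i hi
  exact hle ⟨f, hf, rfl⟩

theorem derivation_aeval_sub_mem (D : Derivation R A A) {n : σ} (hu : ∀ i ∈ s, u i ∈ C)
    (hD : ∀ i ∈ s, i ≠ n → D (u i) ∈ C) {f : MvPolynomial σ R} (hf : f ∈ supported R s) :
    D (aeval u f) - aeval u (pderiv n f) * D (u n) ∈ C := by
  classical
  induction hf using Algebra.adjoin_induction with
  | mem f hf =>
    obtain ⟨i, hi, rfl⟩ := hf
    rw [pderiv_X, aeval_X]
    rcases eq_or_ne i n with rfl | hin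
    · simp [zero_mem]
    · simpa [Pi.single_eq_of_ne hin] using hD i hi hin
  | algebraMap r => simp [zero_mem]
  | add f g _ _ hf hg =>
    convert add_mem hf hg using 1
    simp only [map_add]
    ring
  | mul f g hfs hgs hf hg =>
    convert add_mem (mul_mem (aeval_mem_of_mem_supported hu hfs) hg)
      (mul_mem (aeval_mem_of_mem_supported hu hgs) hf) using 1
    simp only [map_mul, map_add, Derivation.leibniz, smul_eq_mul]
    ring

end PartialDerivatives

namespace PoissonAlgebra

section AddIdeal

variable {R A : Type*} [CommRing R] [CommRing A] [Algebra R A]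

/-- The subalgebra `B + T`, for a subalgebra `B` and an ideal `T`, encoded as the preimage of the
image of `B` in `A ⧸ T`. -/
def addIdeal (B : Subalgebra R A) (T : Ideal A) : Subalgebra R A :=
  (B.map (Ideal.Quotient.mkₐ R T)).comap (Ideal.Quotient.mkₐ R T)

variable {B : Subalgebra R A} {T : Ideal A}

theorem mem_addIdeal {a : A} : a ∈ addIdeal B T ↔ ∃ b ∈ B, a - b ∈ T := by
  simp [addIdeal, Ideal.Quotient.mk_eq_mk_iff_sub_mem, eq_comm]

theorem le_addIdeal : B ≤ addIdeal B T := fun b hb => mem_addIdeal.2 ⟨b, hb, by simp⟩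

theorem mem_addIdeal_of_mem_ideal {t : A} (ht : t ∈ T) : t ∈ addIdeal B T :=
  mem_addIdeal.2 ⟨0, zero_mem B, by simpa⟩

theorem exists_fg_le_forall_mem_of_fg [IsNoetherianRing R] (hB : B.FG) (P : Ideal A) :
    ∃ G : Ideal A, G.FG ∧ G ≤ P ∧ ∀ b ∈ B, b ∈ P → b ∈ G := by
  have := isNoetherianRing_of_fg hB
  exact ⟨(P.comap B.val).map B.val, (Ideal.fg_of_isNoetherianRing _).map _, Ideal.map_comap_le,
    fun b hb hbP => Ideal.mem_map_of_mem B.val (x := ⟨b, hb⟩) hbP⟩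

theorem mul_span_singleton_le_of_saturation_addIdeal_eq_top {P : Ideal A} (hT : T.IsRadical)
    (hTP : T ≤ P) (hBT : ∀ b ∈ B, b ∈ P → b ∈ T) {s : A} (hs : s ∈ addIdeal B T)
    (htop : (addIdeal B T).saturation (.powers s) (Submonoid.powers_le.2 hs) = ⊤) :
    P * Ideal.span {s} ≤ T := by
  rw [mul_comm, Ideal.span_singleton_mul_le_iff]
  intro p hp
  obtain ⟨_, ⟨d, rfl⟩, hd⟩ := Subalgebra.mem_saturation_iff.1 (Algebra.eq_top_iff.1 htop p)
  obtain ⟨b, hb, hbT⟩ : ∃ b ∈ B, s ^ d * p - b ∈ T := mem_addIdeal.1 hd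
  have hbP : b ∈ P := by
    simpa using P.sub_mem (P.mul_mem_left (s ^ d) hp) (hTP hbT)
  have hdT : s ^ d * p ∈ T := by
    simpa using T.add_mem hbT (hBT b hb hbP)
  refine hT ⟨d + 1, ?_⟩
  convert T.mul_mem_left (s * p ^ d) hdT using 1
  ring

end AddIdeal

section TriangularBrackets

variable {R A ι : Type*} [CommRing R] [CommRing A] [Algebra R A] [PoissonAlgebra R A]

variable (R) in
/-- The derivation `{a, ·}`. -/
def bracketDerivation (a : A) : Derivation R A A :=
  Derivation.mk' (bracket a) fun b c => by
    rw [bracket_mul, smul_eq_mul, smul_eq_mul]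
    ring

variable [LinearOrder ι]

variable (R) in
/-- The bracket with `y` is triangular from `n` to `m`, relative to a family `u`, if it sends `u n`
to `u m` and each `u j` with `j < n` to `0`, both up to polynomials in the `u l` with `l < m`. -/
structure IsTriangularBracket (u : ι → A) (n m : ι) (y : A) : Prop where
  bracket_sub_mem : bracket (R := R) y (u n) - u m ∈ Algebra.adjoin R (u '' Set.Iio m)
  bracket_mem : ∀ j < n, bracket (R := R) y (u j) ∈ Algebra.adjoin R (u '' Set.Iio m)

variable (R) in
/-- Every member of the family `u` can be moved by triangular brackets to all but finitely many
members of the family. -/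
def HasTriangularBrackets (u : ι → A) : Prop :=
  ∀ n, ∀ᶠ m in Filter.cofinite, ∃ y, IsTriangularBracket R u n m y

open MvPolynomial

variable {u : ι → A}

theorem IsTriangularBracket.aeval_pderiv_mul_mem {n m : ι} {y : A}
    (hy : IsTriangularBracket R u n m y) {C : Subalgebra R A} (hlt : ∀ l < m, u l ∈ C)
    {f : MvPolynomial ι R} (hvars : ∀ i ∈ f.vars, i ≤ n ∧ u i ∈ C)
    (hpderiv : aeval u (pderiv n f) ∈ C) (hbracket : bracket (R := R) y (aeval u f) ∈ C) :
    aeval u (pderiv n f) * u m ∈ C := by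
  have hle : Algebra.adjoin R (u '' Set.Iio m) ≤ C :=
    Algebra.adjoin_le (Set.image_subset_iff.2 hlt)
  have hchain : bracket (R := R) y (aeval u f)
      - aeval u (pderiv n f) * bracket (R := R) y (u n) ∈ C :=
    derivation_aeval_sub_mem (bracketDerivation R y) (fun i hi => (hvars i hi).2)
      (fun i hi hin => hle (hy.bracket_mem i ((hvars i hi).1.lt_of_ne hin)))
      (mem_supported_vars f)
  have hlead := mul_mem hpderiv (hle hy.bracket_sub_mem)
  convert sub_mem (sub_mem hbracket hchain) hlead using 1
  ring

theorem saturation_addIdeal_eq_top [WellFoundedLT ι] (hgen : Algebra.adjoin R (Set.range u) = ⊤)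
    {T : Ideal A} (hT : T.IsPoisson R) {B : Subalgebra R A} {n : ι}
    (hB : ∀ m, u m ∉ B → ∃ y, IsTriangularBracket R u n m y) {f : MvPolynomial ι R}
    (hvars : ∀ i ∈ f.vars, i ≤ n ∧ u i ∈ B) (hfT : aeval u f ∈ T)
    (hpderiv : aeval u (pderiv n f) ∈ addIdeal B T) :
    (addIdeal B T).saturation (.powers (aeval u (pderiv n f))) (Submonoid.powers_le.2 hpderiv)
      = ⊤ := by
  set C := (addIdeal B T).saturation _ (Submonoid.powers_le.2 hpderiv)
  have hBC : B ≤ C := le_addIdeal.trans Subalgebra.le_saturation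
  rw [← top_le_iff, ← hgen, Algebra.adjoin_le_iff]
  rintro _ ⟨m, rfl⟩
  induction m using WellFoundedLT.induction with
  | ind m ih =>
    by_cases hm : u m ∈ B
    · exact hBC hm
    obtain ⟨y, hy⟩ := hB m hm
    refine Subalgebra.mem_saturation_of_mul_mem_left ?_ (Submonoid.mem_powers _)
    exact hy.aeval_pderiv_mul_mem ih (fun i hi => (hvars i hi).imp_right (@hBC _))
      (Subalgebra.le_saturation hpderiv)
      (Subalgebra.le_saturation (mem_addIdeal_of_mem_ideal (hT y _ hfT)))

theorem exists_fg_mul_span_le [IsNoetherianRing R] [WellFoundedLT ι]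
    (hgen : Algebra.adjoin R (Set.range u) = ⊤) (hu : HasTriangularBrackets R u) {P : Ideal A}
    (hP : (poissonRadical R A).IsClosed P) {f : MvPolynomial ι R} (hfP : aeval u f ∈ P) {n : ι}
    (hn : ∀ i ∈ f.vars, i ≤ n) :
    ∃ G : Ideal A, G.FG ∧ G ≤ P ∧
      P * Ideal.span {aeval u (pderiv n f)} ≤ poissonRadical R A G := by
  let S : Set ι := {m | ¬ ∃ y, IsTriangularBracket R u n m y} ∪ (f.vars ∪ (pderiv n f).vars)
  have hS : S.Finite :=
    Set.Finite.union (hu n) (f.vars.finite_toSet.union (pderiv n f).vars.finite_toSet)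
  let B : Subalgebra R A := Algebra.adjoin R (u '' S)
  have huB {i : ι} (hi : i ∈ S) : u i ∈ B := Algebra.subset_adjoin ⟨i, hi, rfl⟩
  have haevalB {g : MvPolynomial ι R} (hg : (g.vars : Set ι) ⊆ S) : aeval u g ∈ B :=
    aeval_mem_of_mem_supported (fun i hi => huB (hg hi)) (mem_supported_vars g)
  obtain ⟨G, hG, hGP, hBG⟩ :=
    exists_fg_le_forall_mem_of_fg (Subalgebra.fg_def.2 ⟨_, hS.image u, rfl⟩ : B.FG) P
  set T := poissonRadical R A G
  have hTP : T ≤ P := ClosureOperator.closure_min hGP hP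
  have hGT : G ≤ T := (poissonRadical R A).le_closure G
  have hT : (poissonRadical R A).IsClosed T := (poissonRadical R A).isClosed_closure G
  have hfT : aeval u f ∈ T := hGT (hBG _ (haevalB fun i hi => Or.inr (Or.inl hi)) hfP)
  have hpderiv : aeval u (pderiv n f) ∈ addIdeal B T :=
    le_addIdeal (haevalB fun i hi => Or.inr (Or.inr hi))
  have htop := saturation_addIdeal_eq_top hgen hT.2
    (fun m hm => by_contra fun h => hm (huB (Or.inl h)))
    (fun i hi => ⟨hn i hi, huB (Or.inr (Or.inl hi))⟩) hfT hpderiv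
  exact ⟨G, hG, hGP, mul_span_singleton_le_of_saturation_addIdeal_eq_top hT.1 hTP
    (fun b hb hbP => hGT (hBG b hb hbP)) hpderiv htop⟩

end TriangularBrackets

end PoissonAlgebra

open PoissonAlgebra in
theorem theorem2p13_general {k A ι : Type*} [Field k] [CharZero k] [CommRing A] [Algebra k A]
    [PoissonAlgebra k A] [LinearOrder ι] [WellFoundedLT ι] {u : ι → A}
    (hgen : Algebra.adjoin k (Set.range u) = ⊤) (hu : HasTriangularBrackets k u)
    (I : ℕ → Ideal A) (hrad : ∀ n, (I n).IsRadical) (hpoisson : ∀ n, (I n).IsPoisson k)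
    (hmono : ∀ n, I n ≤ I (n + 1)) :
    ∃ N, ∀ n, N ≤ n → I n = I N := by
  have hsurj : Function.Surjective (MvPolynomial.aeval u : MvPolynomial ι k →ₐ[k] A) := by
    rw [← AlgHom.range_eq_top, ← Algebra.adjoin_range_eq_range_aeval, hgen]
  refine exists_forall_ge_eq_of_isRadicallyFG
    (fun P => isRadicallyFG_of_forall_exists_mul_le fun P hP hbot htop => ?_)
    (fun n => ⟨hrad n, hpoisson n⟩) (monotone_nat_of_le_succ hmono)
  obtain ⟨f, hf, hvars, hpderiv⟩ := exists_mem_forall_pderiv_notMem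
    (P := P.comap (MvPolynomial.aeval u : MvPolynomial ι k →ₐ[k] A))
    (fun h => hbot (by rw [← Ideal.map_comap_of_surjective _ hsurj P, h, Ideal.map_bot]))
    (mt Ideal.comap_eq_top_iff.1 htop)
  obtain ⟨G, hG, hGP, hmul⟩ := exists_fg_mul_span_le hgen hu hP hf
    (n := f.vars.max' hvars) f.vars.le_max'
  exact ⟨_, G, mt (Ideal.span_singleton_le_iff_mem P).1 (hpderiv _ (f.vars.max'_mem hvars)),
    hG, hGP, hmul⟩

theorem adjoin_range_ι_basis {R M κ : Type*} [CommRing R] [AddCommGroup M] [Module R M]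
    (b : Module.Basis κ R M) :
    Algebra.adjoin R (Set.range fun i => SymmetricAlgebra.ι R M (b i)) = ⊤ := by
  have himage : (Set.range fun i => SymmetricAlgebra.ι R M (b i)) =
      (SymmetricAlgebra.equivMvPolynomial b).symm.toAlgHom '' Set.range MvPolynomial.X := by
    rw [← Set.range_comp]
    exact congrArg Set.range (funext fun i => (SymmetricAlgebra.equivMvPolynomial_symm_X b i).symm)
  rw [himage, ← AlgHom.map_adjoin, MvPolynomial.adjoin_range_X, Algebra.map_top,
    AlgHom.range_eq_top]
  exact (SymmetricAlgebra.equivMvPolynomial b).symm.surjective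

open PoissonAlgebra in
theorem PositiveWitt.hasTriangularBrackets_e {k : Type*} [Field k] [CharZero k] :
    HasTriangularBrackets k fun i => SymmetricAlgebra.ι k (PositiveWitt k) (e k i) := by
  intro n
  refine (Set.finite_Iic (n + n)).subset fun m hm => Set.mem_Iic.2 (not_lt.1 fun hlt => hm ?_)
  obtain ⟨i, rfl⟩ : ∃ i, m = i + n :=
    ⟨m - n, (PNat.sub_add_of_lt ((PNat.lt_add_left n n).trans hlt)).symm⟩
  have hni : n < i := lt_of_add_lt_add_right hlt
  have hne : ((n : ℕ) : k) - ((i : ℕ) : k) ≠ 0 :=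
    sub_ne_zero.2 fun h => hni.ne (PNat.coe_injective (Nat.cast_injective h))
  let y := (((n : ℕ) : k) - ((i : ℕ) : k))⁻¹ • SymmetricAlgebra.ι k (PositiveWitt k) (e k i)
  have bracket_y_e (j : ℕ+) :
      bracket (R := k) y (SymmetricAlgebra.ι k (PositiveWitt k) (e k j)) =
        ((((n : ℕ) : k) - ((i : ℕ) : k))⁻¹ * (((j : ℕ) : k) - ((i : ℕ) : k))) •
          SymmetricAlgebra.ι k (PositiveWitt k) (e k (i + j)) := by
    rw [map_smul, LinearMap.smul_apply, SymmetricAlgebra.poisson_bracket_ι, e_lie_e, map_smul,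
      smul_smul]
  refine ⟨y, ?_, fun j hj => ?_⟩
  · rw [bracket_y_e n, inv_mul_cancel₀ hne, one_smul, sub_self]
    exact zero_mem _
  · rw [bracket_y_e j]
    refine Subalgebra.smul_mem _ (Algebra.subset_adjoin ?_) _
    exact ⟨i + j, add_lt_add_right hj i, rfl⟩

theorem theorem2p13 {k : Type*} [Field k] [CharZero k]
    (I : ℕ → Ideal (SymmetricAlgebra k (PositiveWitt k)))
    (hrad : ∀ n, (I n).IsRadical) (hpoisson : ∀ n, (I n).IsPoisson k)
    (hmono : ∀ n, I n ≤ I (n + 1)) :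
    ∃ N, ∀ n, N ≤ n → I n = I N := by
  exact theorem2p13_general (adjoin_range_ι_basis (PositiveWitt.e k))
    PositiveWitt.hasTriangularBrackets_e I hrad hpoisson hmono
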